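/- A cotree is a rooted binary tree in which every nonleaf node has a left and a right child and is either a union node or a join node, and every leaf carries a graph consisting of a single vertex, distinct leaves carrying distinct vertices. It defines a graph at each of its nodes: at a leaf, the given one-vertex graph; at a union node, the disjoint union of the graphs at its two children; at a join node, the disjoint union of the graphs at its two children together with all edges between them. A finite simple graph $G$ is a cograph if it is the graph at the root of some cotree. For a finite simple graph $G$ and an integer $k$, let $\mathrm{TAR}_k(G)$ be the graph whose vertices are the independent sets of $G$ of size at least $k$, two distinct independent sets $I$ and $J$ being adjacent if there is a vertex $v\in V(G)$ with $I\cup\{v\}=J$ or $I=J\cup\{v\}$. Corollary. Let $G$ be a cograph on $n$ vertices and let $k$ be an integer. Then every connected component of $\mathrm{TAR}_k(G)$ has (finite) diameter at most $4n-2k$. -/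

import Mathlib

universe u

/-- Rooted ordered binary trees whose leaves carry elements of `V` (trivial leaves: the graph at a
leaf consists of that single vertex) and whose nonleaf nodes, each with a left and a right child,
are partitioned into union nodes and join nodes. -/
inductive Cotree (V : Type u) : Type u
  | leaf (v : V) : Cotree V
  | union (l r : Cotree V) : Cotree V
  | join (l r : Cotree V) : Cotree V

namespace Cotree

variable {V : Type u}

/-- The vertex set of the graph at the root of the tree. -/
def verts : Cotree V → Set V
  | leaf v => {v}
  | union l r => l.verts ∪ r.verts
  | join l r => l.verts ∪ r.verts

/-- The graphs at distinct leaves are vertex disjoint: at every nonleaf node the two children have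
disjoint vertex sets. -/
def VertexDisjoint : Cotree V → Prop
  | leaf _ => True
  | union l r => l.VertexDisjoint ∧ r.VertexDisjoint ∧ Disjoint l.verts r.verts
  | join l r => l.VertexDisjoint ∧ r.VertexDisjoint ∧ Disjoint l.verts r.verts

/-- The edges of the graph at the root of the tree: none at a leaf, those of both children at a
union node, and in addition all edges between the two children at a join node. It is recorded as a
graph on the ambient type `V`, where the elements outside `verts` are isolated. -/
def graph : Cotree V → SimpleGraph V
  | leaf _ => ⊥
  | union l r => l.graph ⊔ r.graph
  | join l r => l.graph ⊔ r.graph ⊔ SimpleGraph.fromRel (fun y z => y ∈ l.verts ∧ z ∈ r.verts)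

/-- `T` is a cotree for the graph `G` with vertex set `V`. -/
def IsCotreeFor (T : Cotree V) (G : SimpleGraph V) : Prop :=
  T.VertexDisjoint ∧ T.verts = Set.univ ∧ T.graph = G

end Cotree

namespace SimpleGraph

variable {V : Type u}

/-- A graph is a cograph if there exists a cotree for it. -/
def IsCograph (G : SimpleGraph V) : Prop :=
  ∃ T : Cotree V, T.IsCotreeFor G

/-- The finite independent sets of `G` with at least `k` elements. -/
abbrev TARVertex (G : SimpleGraph V) (k : ℤ) : Type u :=
  {I : Finset V // G.IsIndepSet (I : Set V) ∧ k ≤ (I.card : ℤ)}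

/-- The token addition and removal graph `TAR_k(G)`: its vertices are the independent sets of `G`
of size at least `k`, and two distinct ones are adjacent if one is obtained from the other by
adding a single vertex. -/
def TAR [DecidableEq V] (G : SimpleGraph V) (k : ℤ) : SimpleGraph (G.TARVertex k) where
  Adj I J := I ≠ J ∧ ∃ v : V, I.1 ∪ {v} = J.1 ∨ I.1 = J.1 ∪ {v}
  symm := ⟨fun _ _ h => ⟨h.1.symm, h.2.imp fun _ hv => hv.symm.imp Eq.symm Eq.symm⟩⟩
  loopless := ⟨fun _ h => h.1 rfl⟩

end SimpleGraph

/-! Each component contains exactly one distinguished set, and every set reaches it cheaply; two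
sets are then joined through it. The distinguished sets are those S that dominate themselves at
bound k. Domination can be followed down the cotree. While the bound is positive, a join confines
all tokens to one child, and no sequence of moves changes that child. At a union, each child gets
the residual bound left after the tokens of S in the other child are counted. Once the bound is
nonpositive, everything connects to the canonical maximum set `maxIndep`, so only that set is
accepted there. Uniqueness: a dominating set keeps dominating along moves
(`Dominates.of_comparable`), so self-dominating S and S' in one component dominate each other, and
`Dominates.antisymm` gives S = S'. Cost: if I does not dominate itself, some part of it can be moved
to the canonical set of a subtree, and the additions used are paid for by a drop in `potential`
(`exists_tokenWalk_of_not_dominates`). The potential of I is at most n - |I|, so I reaches S in at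
most 2n - |I| - |S| moves. -/

namespace Cotree

variable {V : Type u}

theorem not_subset_of_nonempty {A L R : Finset V} (hd : Disjoint L R) (hA : A.Nonempty)
    (hL : A ⊆ L) : ¬ A ⊆ R := by
  obtain ⟨x, hx⟩ := hA
  exact fun hR => Finset.disjoint_left.1 hd (hL hx) (hR hx)

theorem nonempty_of_le_card {I : Finset V} {k : ℤ} (hk : 0 < k) (h : k ≤ I.card) :
    I.Nonempty := by
  rw [← Finset.card_pos]
  omega

variable [DecidableEq V]

/-- The vertex set of the graph at the root of the tree, as a finset. -/
def support : Cotree V → Finset V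
  | leaf v => {v}
  | union l r => l.support ∪ r.support
  | join l r => l.support ∪ r.support

/-- The leaves below the two children of every node carry distinct vertices. -/
def Proper : Cotree V → Prop
  | leaf _ => True
  | union l r => l.Proper ∧ r.Proper ∧ Disjoint l.support r.support
  | join l r => l.Proper ∧ r.Proper ∧ Disjoint l.support r.support

/-- A recursive description of the independent sets of the graph at the root of the tree. -/
def Indep : Cotree V → Finset V → Prop
  | leaf v, I => I ⊆ {v}
  | union l r, I =>
      I ⊆ l.support ∪ r.support ∧ l.Indep (I ∩ l.support) ∧ r.Indep (I ∩ r.support)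
  | join l r, I => l.Indep I ∨ r.Indep I

/-- A canonical maximum independent set. -/
def maxIndep : Cotree V → Finset V
  | leaf v => {v}
  | union l r => l.maxIndep ∪ r.maxIndep
  | join l r => if r.maxIndep.card ≤ l.maxIndep.card then l.maxIndep else r.maxIndep

/-- `T.Dominates k S J` says that `S` is the canonical maximum independent set, or else that `k` is
positive and the tokens of both `S` and `J` occupy the same child at a join node, `S` dominating `J`
there, while at a union node `S` dominates `J` in both children, for the bounds that are left when
the tokens of `S` on the other child are discounted. -/
def Dominates : Cotree V → ℤ → Finset V → Finset V → Prop
  | leaf v, _, S, _ => S = {v}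
  | union l r, k, S, J => S = l.maxIndep ∪ r.maxIndep ∨ 0 < k ∧
      l.Dominates (k - (S ∩ r.support).card) (S ∩ l.support) (J ∩ l.support) ∧
      r.Dominates (k - (S ∩ l.support).card) (S ∩ r.support) (J ∩ r.support)
  | join l r, k, S, J => S = (join l r).maxIndep ∨ 0 < k ∧
      (S ⊆ l.support ∧ J ⊆ l.support ∧ l.Dominates k S J ∨
        S ⊆ r.support ∧ J ⊆ r.support ∧ r.Dominates k S J)

/-- A bound for the number of additions needed to turn `I` into a set that dominates itself. -/
def potential : Cotree V → Finset V → ℕ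
  | leaf v, I => (({v} : Finset V) \ I).card
  | union l r, I => l.potential (I ∩ l.support) + r.potential (I ∩ r.support)
  | join l r, I =>
      if I = (join l r).maxIndep then 0
      else if I ⊆ l.support then l.potential I + r.support.card
      else r.potential I + l.support.card

/-! ### Independent sets along the cotree and the canonical maximum set -/

theorem coe_support (T : Cotree V) : (T.support : Set V) = T.verts := by
  induction T <;> simp_all [support, verts]

theorem VertexDisjoint.proper {T : Cotree V} (h : T.VertexDisjoint) : T.Proper := by
  induction T with
  | leaf v => trivial
  | union l r hl hr =>
    exact ⟨hl h.1, hr h.2.1, by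
      rw [← Finset.disjoint_coe, coe_support, coe_support]; exact h.2.2⟩
  | join l r hl hr =>
    exact ⟨hl h.1, hr h.2.1, by
      rw [← Finset.disjoint_coe, coe_support, coe_support]; exact h.2.2⟩

theorem Indep.subset {T : Cotree V} {I : Finset V} (h : T.Indep I) : I ⊆ T.support := by
  induction T generalizing I with
  | leaf v => exact h
  | union l r hl hr => exact h.1
  | join l r hl hr =>
    rcases h with h | h
    · exact (hl h).trans Finset.subset_union_left
    · exact (hr h).trans Finset.subset_union_right

theorem Indep.mono {T : Cotree V} {I J : Finset V} (h : T.Indep I) (hJ : J ⊆ I) : T.Indep J := by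
  induction T generalizing I J with
  | leaf v => exact hJ.trans h
  | union l r hl hr =>
    exact ⟨hJ.trans h.1, hl h.2.1 (Finset.inter_subset_inter_right hJ),
      hr h.2.2 (Finset.inter_subset_inter_right hJ)⟩
  | join l r hl hr => exact h.imp (fun h => hl h hJ) (fun h => hr h hJ)

theorem adj_graph_mem {T : Cotree V} {x y : V} (h : T.graph.Adj x y) :
    x ∈ T.support ∧ y ∈ T.support := by
  induction T with
  | leaf v => simp [graph] at h
  | union l r hl hr =>
    simp only [graph, SimpleGraph.sup_adj] at h
    simp only [support, Finset.mem_union]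
    rcases h with h | h
    · exact ⟨.inl (hl h).1, .inl (hl h).2⟩
    · exact ⟨.inr (hr h).1, .inr (hr h).2⟩
  | join l r hl hr =>
    simp only [graph, SimpleGraph.sup_adj, SimpleGraph.fromRel_adj, ← coe_support,
      Finset.mem_coe] at h
    simp only [support, Finset.mem_union]
    rcases h with (h | h) | ⟨-, h | h⟩
    · exact ⟨.inl (hl h).1, .inl (hl h).2⟩
    · exact ⟨.inr (hr h).1, .inr (hr h).2⟩
    · exact ⟨.inl h.1, .inr h.2⟩
    · exact ⟨.inr h.2, .inl h.1⟩

theorem indep_iff {T : Cotree V} (hT : T.Proper) {I : Finset V} (hI : I ⊆ T.support) :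
    T.Indep I ↔ T.graph.IsIndepSet (I : Set V) := by
  induction T generalizing I with
  | leaf v =>
    simp only [graph, Indep, SimpleGraph.IsIndepSet, SimpleGraph.bot_adj, not_false_eq_true]
    exact ⟨fun _ _ _ _ _ _ => trivial, fun _ => hI⟩
  | union l r hl hr =>
    simp only [Indep, hl hT.1 Finset.inter_subset_right, hr hT.2.1 Finset.inter_subset_right]
    constructor
    · rintro ⟨-, h1, h2⟩ x hx y hy hxy hadj
      rcases hadj with hadj | hadj
      · exact h1 (by simpa using ⟨hx, (adj_graph_mem hadj).1⟩)
          (by simpa using ⟨hy, (adj_graph_mem hadj).2⟩) hxy hadj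
      · exact h2 (by simpa using ⟨hx, (adj_graph_mem hadj).1⟩)
          (by simpa using ⟨hy, (adj_graph_mem hadj).2⟩) hxy hadj
    · intro h
      refine ⟨hI, fun x hx y hy hxy hadj => ?_, fun x hx y hy hxy hadj => ?_⟩
      · exact h (Finset.mem_inter.1 hx).1 (Finset.mem_inter.1 hy).1 hxy (Or.inl hadj)
      · exact h (Finset.mem_inter.1 hx).1 (Finset.mem_inter.1 hy).1 hxy (Or.inr hadj)
  | join l r hl hr =>
    have hd := Finset.disjoint_left.1 hT.2.2
    constructor
    · rintro (h | h) x hx y hy hxy hadj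
      · have hs := h.subset
        simp only [graph, SimpleGraph.sup_adj, SimpleGraph.fromRel_adj, ← coe_support,
          Finset.mem_coe] at hadj
        rcases hadj with (ha | ha) | ⟨-, ha | ha⟩
        · exact (hl hT.1 hs).1 h hx hy hxy ha
        · exact hd (hs hx) (adj_graph_mem ha).1
        · exact hd (hs hy) ha.2
        · exact hd (hs hx) ha.2
      · have hs := h.subset
        simp only [graph, SimpleGraph.sup_adj, SimpleGraph.fromRel_adj, ← coe_support,
          Finset.mem_coe] at hadj
        rcases hadj with (ha | ha) | ⟨-, ha | ha⟩
        · exact hd (adj_graph_mem ha).1 (hs hx)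
        · exact (hr hT.2.1 hs).1 h hx hy hxy ha
        · exact hd ha.1 (hs hx)
        · exact hd ha.1 (hs hy)
    · intro h
      have key : I ⊆ l.support ∨ I ⊆ r.support := by
        by_contra! hc
        obtain ⟨⟨x, hx, hxl⟩, ⟨y, hy, hyr⟩⟩ :=
          And.intro (Finset.not_subset.1 hc.1) (Finset.not_subset.1 hc.2)
        have hxr := (Finset.mem_union.1 (hI hx)).resolve_left hxl
        have hyl := (Finset.mem_union.1 (hI hy)).resolve_right hyr
        have hxy : x ≠ y := fun e => hxl (e ▸ hyl)
        refine h hx hy hxy ?_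
        simp only [graph, SimpleGraph.sup_adj, SimpleGraph.fromRel_adj, ← coe_support,
          Finset.mem_coe]
        exact Or.inr ⟨hxy, Or.inr ⟨hyl, hxr⟩⟩
      refine key.imp (fun hs => (hl hT.1 hs).2 ?_) (fun hs => (hr hT.2.1 hs).2 ?_)
      · exact fun x hx y hy hxy ha => h hx hy hxy (Or.inl (Or.inl ha))
      · exact fun x hx y hy hxy ha => h hx hy hxy (Or.inl (Or.inr ha))

theorem maxIndep_subset (T : Cotree V) : T.maxIndep ⊆ T.support := by
  induction T with
  | leaf v => exact subset_rfl
  | union l r hl hr => exact Finset.union_subset_union hl hr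
  | join l r hl hr =>
    simp only [maxIndep]
    split_ifs
    · exact hl.trans Finset.subset_union_left
    · exact hr.trans Finset.subset_union_right

theorem union_inter_left {A B L R : Finset V} (h : Disjoint L R) (hA : A ⊆ L) (hB : B ⊆ R) :
    (A ∪ B) ∩ L = A := by
  rw [Finset.union_inter_distrib_right, Finset.inter_eq_left.2 hA,
    Finset.disjoint_iff_inter_eq_empty.1 (h.symm.mono_left hB), Finset.union_empty]

theorem union_inter_right {A B L R : Finset V} (h : Disjoint L R) (hA : A ⊆ L) (hB : B ⊆ R) :
    (A ∪ B) ∩ R = B := by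
  rw [Finset.union_comm, union_inter_left h.symm hB hA]

theorem inter_union_inter {I L R : Finset V} (h : I ⊆ L ∪ R) : I ∩ L ∪ I ∩ R = I := by
  rw [← Finset.inter_union_distrib_left, Finset.inter_eq_left.2 h]

theorem card_inter_add {I L R : Finset V} (hd : Disjoint L R) (h : I ⊆ L ∪ R) :
    (I ∩ L).card + (I ∩ R).card = I.card := by
  rw [← Finset.card_union_of_disjoint, inter_union_inter h]
  exact hd.mono Finset.inter_subset_right Finset.inter_subset_right

theorem Indep.union {l r : Cotree V} (hd : Disjoint l.support r.support) {A B : Finset V}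
    (hA : l.Indep A) (hB : r.Indep B) : (Cotree.union l r).Indep (A ∪ B) := by
  refine ⟨Finset.union_subset_union hA.subset hB.subset, ?_, ?_⟩
  · rwa [union_inter_left hd hA.subset hB.subset]
  · rwa [union_inter_right hd hA.subset hB.subset]

theorem indep_maxIndep {T : Cotree V} (hT : T.Proper) : T.Indep T.maxIndep := by
  induction T with
  | leaf v => exact subset_rfl
  | union l r hl hr => exact (hl hT.1).union hT.2.2 (hr hT.2.1)
  | join l r hl hr =>
    simp only [maxIndep]
    split_ifs
    · exact Or.inl (hl hT.1)
    · exact Or.inr (hr hT.2.1)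

theorem Indep.card_le {T : Cotree V} (hT : T.Proper) {I : Finset V} (h : T.Indep I) :
    I.card ≤ T.maxIndep.card := by
  induction T generalizing I with
  | leaf v => exact Finset.card_le_card h
  | union l r hl hr =>
    rw [maxIndep, Finset.card_union_of_disjoint
      (hT.2.2.mono l.maxIndep_subset r.maxIndep_subset), ← card_inter_add hT.2.2 h.1]
    exact add_le_add (hl hT.1 h.2.1) (hr hT.2.1 h.2.2)
  | join l r hl hr =>
    have : l.maxIndep.card ≤ (join l r).maxIndep.card ∧
        r.maxIndep.card ≤ (join l r).maxIndep.card := by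
      simp only [maxIndep]
      split_ifs <;> omega
    rcases h with h | h
    · exact (hl hT.1 h).trans this.1
    · exact (hr hT.2.1 h).trans this.2

theorem maxIndep_nonempty (T : Cotree V) : T.maxIndep.Nonempty := by
  induction T with
  | leaf v => exact Finset.singleton_nonempty v
  | union l r hl hr => exact hl.mono Finset.subset_union_left
  | join l r hl hr =>
    simp only [maxIndep]
    split_ifs
    · exact hl
    · exact hr

theorem maxIndep_union_inter_left {l r : Cotree V} (hd : Disjoint l.support r.support) :
    (l.maxIndep ∪ r.maxIndep) ∩ l.support = l.maxIndep :=
  union_inter_left hd l.maxIndep_subset r.maxIndep_subset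

theorem maxIndep_union_inter_right {l r : Cotree V} (hd : Disjoint l.support r.support) :
    (l.maxIndep ∪ r.maxIndep) ∩ r.support = r.maxIndep :=
  union_inter_right hd l.maxIndep_subset r.maxIndep_subset

theorem maxIndep_join_eq_left {l r : Cotree V} (hd : Disjoint l.support r.support)
    (h : (join l r).maxIndep ⊆ l.support) : (join l r).maxIndep = l.maxIndep := by
  simp only [maxIndep] at h ⊢
  split_ifs at h ⊢ with hc
  · rfl
  · exact absurd h (not_subset_of_nonempty hd.symm r.maxIndep_nonempty r.maxIndep_subset)

theorem maxIndep_join_eq_right {l r : Cotree V} (hd : Disjoint l.support r.support)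
    (h : (join l r).maxIndep ⊆ r.support) : (join l r).maxIndep = r.maxIndep := by
  simp only [maxIndep] at h ⊢
  split_ifs at h ⊢ with hc
  · exact absurd h (not_subset_of_nonempty hd l.maxIndep_nonempty l.maxIndep_subset)
  · rfl

/-! ### Domination: invariance under moves and antisymmetry -/

theorem dominates_maxIndep (T : Cotree V) (k : ℤ) (J : Finset V) :
    T.Dominates k T.maxIndep J := by
  cases T with
  | leaf v => exact rfl
  | union l r => exact Or.inl rfl
  | join l r => exact Or.inl rfl

theorem Dominates.left {l r : Cotree V} (hd : Disjoint l.support r.support) {k : ℤ}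
    {S J : Finset V} (h : (Cotree.union l r).Dominates k S J) :
    l.Dominates (k - (S ∩ r.support).card) (S ∩ l.support) (J ∩ l.support) := by
  rcases h with rfl | h
  · rw [maxIndep_union_inter_left hd]
    exact dominates_maxIndep _ _ _
  · exact h.2.1

theorem Dominates.right {l r : Cotree V} (hd : Disjoint l.support r.support) {k : ℤ}
    {S J : Finset V} (h : (Cotree.union l r).Dominates k S J) :
    r.Dominates (k - (S ∩ l.support).card) (S ∩ r.support) (J ∩ r.support) := by
  rcases h with rfl | h
  · rw [maxIndep_union_inter_right hd]
    exact dominates_maxIndep _ _ _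
  · exact h.2.2

theorem indep_left_of_subset {l r : Cotree V} (hd : Disjoint l.support r.support) {I : Finset V}
    (h : (join l r).Indep I) (hn : I.Nonempty) (hs : I ⊆ l.support) : l.Indep I :=
  h.resolve_right fun h => not_subset_of_nonempty hd hn hs h.subset

theorem indep_right_of_subset {l r : Cotree V} (hd : Disjoint l.support r.support) {I : Finset V}
    (h : (join l r).Indep I) (hn : I.Nonempty) (hs : I ⊆ r.support) : r.Indep I :=
  h.resolve_left fun h => not_subset_of_nonempty hd hn h.subset hs

/-- No size bound on S or J is assumed, so this applies in the children before their residual bounds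
are known to be met. -/
theorem Dominates.card_le {T : Cotree V} (hT : T.Proper) {k : ℤ} {S J : Finset V}
    (hS : T.Indep S) (hJ : T.Indep J) (h : T.Dominates k S J) : J.card ≤ S.card := by
  induction T generalizing k S J with
  | leaf v => rw [show S = {v} from h]; exact Finset.card_le_card hJ
  | union l r hl hr =>
    have h1 := hl hT.1 hS.2.1 hJ.2.1 (h.left hT.2.2)
    have h2 := hr hT.2.1 hS.2.2 hJ.2.2 (h.right hT.2.2)
    rw [← card_inter_add hT.2.2 hS.1, ← card_inter_add hT.2.2 hJ.1]
    omega
  | join l r hl hr =>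
    rcases J.eq_empty_or_nonempty with rfl | hJn
    · simp
    -- An empty S does not reveal its child; its independence there is inherited from J.
    rcases S.eq_empty_or_nonempty with rfl | hSn
    · rcases h with h | ⟨hk, ⟨h1, h2, h3⟩ | ⟨h1, h2, h3⟩⟩
      · exact absurd h.symm (join l r).maxIndep_nonempty.ne_empty
      · exact hl hT.1 ((indep_left_of_subset hT.2.2 hJ hJn h2).mono (Finset.empty_subset _))
          (indep_left_of_subset hT.2.2 hJ hJn h2) h3
      · exact hr hT.2.1 ((indep_right_of_subset hT.2.2 hJ hJn h2).mono (Finset.empty_subset _))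
          (indep_right_of_subset hT.2.2 hJ hJn h2) h3
    rcases h with rfl | ⟨hk, ⟨h1, h2, h3⟩ | ⟨h1, h2, h3⟩⟩
    · exact hJ.card_le hT
    · exact hl hT.1 (indep_left_of_subset hT.2.2 hS hSn h1)
        (indep_left_of_subset hT.2.2 hJ hJn h2) h3
    · exact hr hT.2.1 (indep_right_of_subset hT.2.2 hS hSn h1)
        (indep_right_of_subset hT.2.2 hJ hJn h2) h3

/-- Comparable independent sets of size at least `k` are dominated by the same sets. -/
theorem Dominates.of_comparable {T : Cotree V} (hT : T.Proper) {k : ℤ} {S J J' : Finset V}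
    (hS : T.Indep S) (hJ : T.Indep J) (hJ' : T.Indep J') (hkS : k ≤ S.card) (hkJ : k ≤ J.card)
    (hkJ' : k ≤ J'.card) (hc : J ⊆ J' ∨ J' ⊆ J) (h : T.Dominates k S J) :
    T.Dominates k S J' := by
  induction T generalizing k S J J' with
  | leaf v => exact h
  | union l r hl hr =>
    have hd := hT.2.2
    rcases id h with rfl | ⟨hk, -, -⟩
    · exact Or.inl rfl
    have hL := h.left hd
    have hR := h.right hd
    have h1 := hL.card_le hT.1 hS.2.1 hJ.2.1
    have h2 := hR.card_le hT.2.1 hS.2.2 hJ.2.2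
    have c0 := card_inter_add hd hS.1
    have c1 := card_inter_add hd hJ.1
    have c2 := card_inter_add hd hJ'.1
    have hc1 : J ∩ l.support ⊆ J' ∩ l.support ∨ J' ∩ l.support ⊆ J ∩ l.support :=
      hc.imp Finset.inter_subset_inter_right Finset.inter_subset_inter_right
    have hc2 : J ∩ r.support ⊆ J' ∩ r.support ∨ J' ∩ r.support ⊆ J ∩ r.support :=
      hc.imp Finset.inter_subset_inter_right Finset.inter_subset_inter_right
    have hcard : (J ∩ l.support).card ≤ (J' ∩ l.support).card ∧
        (J ∩ r.support).card ≤ (J' ∩ r.support).card ∨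
        (J' ∩ l.support).card ≤ (J ∩ l.support).card ∧
        (J' ∩ r.support).card ≤ (J ∩ r.support).card :=
      hc.imp
        (fun h => ⟨Finset.card_le_card (Finset.inter_subset_inter_right h),
          Finset.card_le_card (Finset.inter_subset_inter_right h)⟩)
        (fun h => ⟨Finset.card_le_card (Finset.inter_subset_inter_right h),
          Finset.card_le_card (Finset.inter_subset_inter_right h)⟩)
    -- J' meets the residual bounds. If it shrinks from J, it has at most as many tokens as S in
    -- either child, so at least k minus that many in the other. If it grows, it inherits the bounds
    -- from J.
    exact Or.inr ⟨hk,
      hl hT.1 hS.2.1 hJ.2.1 hJ'.2.1 (by omega) (by omega) (by omega) hc1 hL,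
      hr hT.2.1 hS.2.2 hJ.2.2 hJ'.2.2 (by omega) (by omega) (by omega) hc2 hR⟩
  | join l r hl hr =>
    have hd := hT.2.2
    rcases h with rfl | ⟨hk, h⟩
    · exact Or.inl rfl
    have hSn := nonempty_of_le_card hk hkS
    have hJn := nonempty_of_le_card hk hkJ
    have hJn' := nonempty_of_le_card hk hkJ'
    -- Comparable nonempty independent sets occupy the same child of a join.
    refine Or.inr ⟨hk, h.imp ?_ ?_⟩
    · rintro ⟨h1, h2, h3⟩
      have hs : J' ⊆ l.support := by
        rcases hc with hc | hc
        · rcases hJ' with hJ' | hJ'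
          · exact hJ'.subset
          · exact absurd (hc.trans hJ'.subset) (not_subset_of_nonempty hd hJn h2)
        · exact hc.trans h2
      exact ⟨h1, hs, hl hT.1 (indep_left_of_subset hd hS hSn h1)
        (indep_left_of_subset hd hJ hJn h2) (indep_left_of_subset hd hJ' hJn' hs)
        hkS hkJ hkJ' hc h3⟩
    · rintro ⟨h1, h2, h3⟩
      have hs : J' ⊆ r.support := by
        rcases hc with hc | hc
        · rcases hJ' with hJ' | hJ'
          · exact absurd (hc.trans hJ'.subset) (not_subset_of_nonempty hd.symm hJn h2)
          · exact hJ'.subset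
        · exact hc.trans h2
      exact ⟨h1, hs, hr hT.2.1 (indep_right_of_subset hd hS hSn h1)
        (indep_right_of_subset hd hJ hJn h2) (indep_right_of_subset hd hJ' hJn' hs)
        hkS hkJ hkJ' hc h3⟩

theorem Dominates.join_left {l r : Cotree V} (hd : Disjoint l.support r.support) {k : ℤ}
    {S J : Finset V} (hn : S.Nonempty) (hs : S ⊆ l.support)
    (h : (Cotree.join l r).Dominates k S J) : l.Dominates k S J := by
  rcases h with h | ⟨-, ⟨-, -, h⟩ | ⟨h, -, -⟩⟩
  · rw [h, maxIndep_join_eq_left hd (h ▸ hs)]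
    exact dominates_maxIndep _ _ _
  · exact h
  · exact absurd h (not_subset_of_nonempty hd hn hs)

theorem Dominates.join_right {l r : Cotree V} (hd : Disjoint l.support r.support) {k : ℤ}
    {S J : Finset V} (hn : S.Nonempty) (hs : S ⊆ r.support)
    (h : (Cotree.join l r).Dominates k S J) : r.Dominates k S J := by
  rcases h with h | ⟨-, ⟨h, -, -⟩ | ⟨-, -, h⟩⟩
  · rw [h, maxIndep_join_eq_right hd (h ▸ hs)]
    exact dominates_maxIndep _ _ _
  · exact absurd h (not_subset_of_nonempty hd.symm hn hs)
  · exact h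

/-- At a union, `Dominates.card_le` in both directions equalizes the sizes in each child, so the two
residual bounds agree and induction applies. -/
theorem Dominates.antisymm {T : Cotree V} (hT : T.Proper) {k : ℤ} {S J : Finset V}
    (hS : T.Indep S) (hJ : T.Indep J) (hkS : k ≤ S.card) (hkJ : k ≤ J.card)
    (h : T.Dominates k S J) (h' : T.Dominates k J S) : S = J := by
  induction T generalizing k S J with
  | leaf v => exact (show S = {v} from h).trans (show J = {v} from h').symm
  | union l r hl hr =>
    have hd := hT.2.2
    have e1 := le_antisymm ((h'.left hd).card_le hT.1 hJ.2.1 hS.2.1)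
      ((h.left hd).card_le hT.1 hS.2.1 hJ.2.1)
    have e2 := le_antisymm ((h'.right hd).card_le hT.2.1 hJ.2.2 hS.2.2)
      ((h.right hd).card_le hT.2.1 hS.2.2 hJ.2.2)
    have c1 := card_inter_add hd hS.1
    have c2 := card_inter_add hd hJ.1
    rw [← inter_union_inter hS.1, ← inter_union_inter hJ.1,
      hl hT.1 hS.2.1 hJ.2.1 (by omega) (by omega) (h.left hd) (e2 ▸ h'.left hd),
      hr hT.2.1 hS.2.2 hJ.2.2 (by omega) (by omega) (h.right hd) (e1 ▸ h'.right hd)]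
  | join l r hl hr =>
    have hd := hT.2.2
    have key : S = (join l r).maxIndep ∧ J = (join l r).maxIndep ∨ 0 < k ∧
        (S ⊆ l.support ∧ J ⊆ l.support ∨ S ⊆ r.support ∧ J ⊆ r.support) := by
      rcases id h with h1 | ⟨hk, h1 | h1⟩
      · rcases id h' with h2 | ⟨hk, h2 | h2⟩
        · exact Or.inl ⟨h1, h2⟩
        · exact Or.inr ⟨hk, Or.inl ⟨h2.2.1, h2.1⟩⟩
        · exact Or.inr ⟨hk, Or.inr ⟨h2.2.1, h2.1⟩⟩
      · exact Or.inr ⟨hk, Or.inl ⟨h1.1, h1.2.1⟩⟩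
      · exact Or.inr ⟨hk, Or.inr ⟨h1.1, h1.2.1⟩⟩
    rcases key with ⟨rfl, rfl⟩ | ⟨hk, ⟨s1, s2⟩ | ⟨s1, s2⟩⟩
    · rfl
    · have n1 := nonempty_of_le_card hk hkS
      have n2 := nonempty_of_le_card hk hkJ
      exact hl hT.1 (indep_left_of_subset hd hS n1 s1) (indep_left_of_subset hd hJ n2 s2) hkS hkJ
        (h.join_left hd n1 s1) (h'.join_left hd n2 s2)
    · have n1 := nonempty_of_le_card hk hkS
      have n2 := nonempty_of_le_card hk hkJ
      exact hr hT.2.1 (indep_right_of_subset hd hS n1 s1) (indep_right_of_subset hd hJ n2 s2)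
        hkS hkJ (h.join_right hd n1 s1) (h'.join_right hd n2 s2)

/-! ### Bounds on the potential -/

theorem potential_maxIndep {T : Cotree V} (hT : T.Proper) : T.potential T.maxIndep = 0 := by
  induction T with
  | leaf v => simp [potential, maxIndep]
  | union l r hl hr =>
    rw [potential, maxIndep, maxIndep_union_inter_left hT.2.2, maxIndep_union_inter_right hT.2.2,
      hl hT.1, hr hT.2.1]
  | join l r hl hr => simp [potential]

theorem potential_add_card_le {T : Cotree V} (hT : T.Proper) {I : Finset V} (h : T.Indep I) :
    T.potential I + I.card ≤ T.support.card := by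
  induction T generalizing I with
  | leaf v =>
    rw [potential, Finset.card_sdiff_add_card_eq_card h, support]
  | union l r hl hr =>
    have h1 := hl hT.1 h.2.1
    have h2 := hr hT.2.1 h.2.2
    have h3 := card_inter_add hT.2.2 h.1
    rw [potential, support, Finset.card_union_of_disjoint hT.2.2]
    omega
  | join l r hl hr =>
    have h0 : I.card ≤ l.support.card + r.support.card := by
      rw [← Finset.card_union_of_disjoint hT.2.2]
      exact Finset.card_le_card h.subset
    rw [potential, support, Finset.card_union_of_disjoint hT.2.2]
    split_ifs with h1 h2
    · omega
    -- The empty set lands in this branch whichever child it was independent in.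
    · rcases I.eq_empty_or_nonempty with rfl | hn
      · have := hl hT.1 ((indep_maxIndep hT.1).mono (Finset.empty_subset _))
        omega
      · have := hl hT.1 (indep_left_of_subset hT.2.2 h hn h2)
        omega
    · have := hr hT.2.1 (h.resolve_left fun h => h2 h.subset)
      omega

/-- At a join, the support summand pays for a canonical set lying in the child opposite to I. -/
theorem card_maxIndep_sdiff_le_potential (T : Cotree V) (I : Finset V) :
    (T.maxIndep \ I).card ≤ T.potential I := by
  induction T generalizing I with
  | leaf v => exact le_rfl
  | union l r hl hr =>
    have e : (l.maxIndep ∪ r.maxIndep) \ I ⊆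
        (l.maxIndep \ (I ∩ l.support)) ∪ (r.maxIndep \ (I ∩ r.support)) := by
      intro x hx
      simp only [Finset.mem_sdiff, Finset.mem_union, Finset.mem_inter] at hx ⊢
      tauto
    exact (Finset.card_le_card e).trans ((Finset.card_union_le _ _).trans
      (add_le_add (hl _) (hr _)))
  | join l r hl hr =>
    have h1 := hl I
    have h2 := hr I
    have h3 : (l.maxIndep \ I).card ≤ l.support.card :=
      Finset.card_le_card (Finset.sdiff_subset.trans l.maxIndep_subset)
    have h4 : (r.maxIndep \ I).card ≤ r.support.card :=
      Finset.card_le_card (Finset.sdiff_subset.trans r.maxIndep_subset)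
    rw [potential]
    split_ifs with h5 h6
    · rw [← h5]; simp
    all_goals
      simp only [maxIndep]
      split_ifs <;> omega

end Cotree

/-! ### Walks of finsets -/

/-- `TokenWalk P n I J` says that `J` arises from `I` by `n` additions or removals of single
elements, all sets on the way satisfying `P`. -/
inductive TokenWalk {V : Type u} [DecidableEq V] (P : Finset V → Prop) :
    ℕ → Finset V → Finset V → Prop
  | nil {I : Finset V} : P I → TokenWalk P 0 I I
  | cons {n : ℕ} {I J K : Finset V} : P I → (∃ v, I ∪ {v} = J ∨ I = J ∪ {v}) →
      TokenWalk P n J K → TokenWalk P (n + 1) I K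

namespace TokenWalk

variable {V : Type u} [DecidableEq V] {P Q : Finset V → Prop} {m n : ℕ} {I J K : Finset V}

theorem left (h : TokenWalk P n I J) : P I := by
  cases h <;> assumption

theorem right (h : TokenWalk P n I J) : P J := by
  induction h with
  | nil h => exact h
  | cons _ _ _ ih => exact ih

theorem trans (h : TokenWalk P m I J) (h' : TokenWalk P n J K) : TokenWalk P (m + n) I K := by
  induction h with
  | nil _ => rwa [Nat.zero_add]
  | cons hP hv _ ih =>
    rw [Nat.add_right_comm]
    exact cons hP hv (ih h')

theorem symm (h : TokenWalk P n I J) : TokenWalk P n J I := by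
  induction h with
  | nil h => exact nil h
  | cons hP hv hw ih =>
    exact ih.trans (cons hw.left (hv.imp fun _ h => h.symm.imp Eq.symm Eq.symm) (nil hP))

/-- B need not be disjoint from the walk: a move at a vertex of B becomes a stationary step, which
`TokenWalk` permits. -/
theorem map_union (B : Finset V) (hPQ : ∀ X, P X → Q (X ∪ B)) (h : TokenWalk P n I J) :
    TokenWalk Q n (I ∪ B) (J ∪ B) := by
  induction h with
  | nil h => exact nil (hPQ _ h)
  | cons hP hv _ ih =>
    obtain ⟨v, hv⟩ := hv
    refine cons (hPQ _ hP) ⟨v, ?_⟩ ih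
    rw [Finset.union_right_comm _ B, Finset.union_right_comm _ B]
    exact hv.imp (congrArg (· ∪ B)) (congrArg (· ∪ B))

theorem mono (hPQ : ∀ X, P X → Q X) (h : TokenWalk P n I J) : TokenWalk Q n I J := by
  simpa using h.map_union ∅ (fun X hX => by simpa using hPQ X hX)

theorem of_subset (h : I ⊆ J) (hP : ∀ X, I ⊆ X → X ⊆ J → P X) :
    TokenWalk P (J \ I).card I J := by
  induction hn : (J \ I).card generalizing I with
  | zero =>
    rw [Finset.card_eq_zero, Finset.sdiff_eq_empty_iff_subset] at hn
    obtain rfl := h.antisymm hn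
    exact nil (hP _ h h)
  | succ n ih =>
    obtain ⟨v, hv⟩ : (J \ I).Nonempty := by rw [← Finset.card_pos]; omega
    rw [Finset.mem_sdiff] at hv
    have hsub : I ∪ {v} ⊆ J := Finset.union_subset h (Finset.singleton_subset_iff.2 hv.1)
    refine cons (hP _ subset_rfl h) ⟨v, Or.inl rfl⟩
      (ih hsub (fun X hX => hP X (Finset.subset_union_left.trans hX)) ?_)
    have : J \ (I ∪ {v}) = (J \ I).erase v := by
      ext x
      simp only [Finset.mem_sdiff, Finset.mem_union, Finset.mem_singleton, Finset.mem_erase]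
      tauto
    rw [this, Finset.card_erase_of_mem (Finset.mem_sdiff.2 hv), hn, Nat.add_sub_cancel]

theorem of_downward_closed (hP : ∀ X Y, P X → Y ⊆ X → P Y) (hI : P I) (hJ : P J) :
    TokenWalk P ((I \ J).card + (J \ I).card) I J := by
  have h1 : TokenWalk P (I \ (I ∩ J)).card (I ∩ J) I :=
    of_subset Finset.inter_subset_left fun X _ hX => hP I X hI hX
  have h2 : TokenWalk P (J \ (I ∩ J)).card (I ∩ J) J :=
    of_subset Finset.inter_subset_right fun X _ hX => hP J X hJ hX
  rw [Finset.sdiff_inter_self_left] at h1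
  rw [Finset.sdiff_inter_self_right] at h2
  exact h1.symm.trans h2

end TokenWalk

/-! ### Reaching self-dominating sets -/

namespace Cotree

variable {V : Type u} [DecidableEq V]

/-- With no effective size bound, tokens outside the canonical set are removed and the missing ones
added. For a walk with a additions and no stationary steps, n + |J| - |I| = 2a, so the last
inequality says that the potential drops by at least a. In this form it telescopes. -/
theorem exists_tokenWalk_maxIndep {T : Cotree V} (hT : T.Proper) {k : ℤ} (hk : k ≤ 0)
    {I : Finset V} (hI : T.Indep I) (hne : I ≠ T.maxIndep) :
    ∃ n J, TokenWalk (fun X => T.Indep X ∧ k ≤ X.card) n I J ∧ T.potential J < T.potential I ∧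
      n + 2 * T.potential J + J.card ≤ 2 * T.potential I + I.card := by
  have hM := indep_maxIndep hT
  have hle := card_maxIndep_sdiff_le_potential T I
  have hpos : 0 < (T.maxIndep \ I).card := by
    rw [Finset.card_pos, Finset.sdiff_nonempty]
    exact fun h => hne (Finset.eq_of_subset_of_card_le h (hI.card_le hT)).symm
  have c1 := Finset.card_sdiff_add_card_inter I T.maxIndep
  have c2 := Finset.card_sdiff_add_card_inter T.maxIndep I
  rw [Finset.inter_comm] at c2
  refine ⟨_, T.maxIndep, TokenWalk.of_downward_closed ?_ ⟨hI, by omega⟩ ⟨hM, by omega⟩, ?_, ?_⟩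
  · exact fun X Y hX hY => ⟨hX.1.mono hY, by omega⟩
  · rw [potential_maxIndep hT]
    omega
  · rw [potential_maxIndep hT]
    omega

theorem potential_join_le_left (l r : Cotree V) {I : Finset V} (h : I ⊆ l.support) :
    (join l r).potential I ≤ l.potential I + r.support.card := by
  rw [potential]
  split_ifs
  · omega
  · exact le_rfl

theorem potential_join_le_right {l r : Cotree V} (hd : Disjoint l.support r.support)
    {I : Finset V} (hn : I.Nonempty) (h : I ⊆ r.support) :
    (join l r).potential I ≤ r.potential I + l.support.card := by
  rw [potential, if_neg (not_subset_of_nonempty hd.symm hn h)]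
  split_ifs
  · omega
  · exact le_rfl

/-- Failure of self-domination descends to a child: the occupied one at a join, some one at a union,
where the tokens of the other child stay frozen. -/
theorem exists_tokenWalk_of_not_dominates {T : Cotree V} (hT : T.Proper) {k : ℤ} {I : Finset V}
    (hI : T.Indep I) (hkI : k ≤ I.card) (h : ¬ T.Dominates k I I) :
    ∃ n J, TokenWalk (fun X => T.Indep X ∧ k ≤ X.card) n I J ∧ T.potential J < T.potential I ∧
      n + 2 * T.potential J + J.card ≤ 2 * T.potential I + I.card := by
  have hne : I ≠ T.maxIndep := by
    intro e
    apply h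
    nth_rw 1 [e]
    exact dominates_maxIndep _ _ _
  rcases le_or_gt k 0 with hk | hk
  · exact exists_tokenWalk_maxIndep hT hk hI hne
  induction T generalizing k I with
  | leaf v =>
    refine absurd ?_ hne
    exact (Finset.subset_singleton_iff.1 hI).resolve_left (nonempty_of_le_card hk hkI).ne_empty
  | union l r hl hr =>
    have hd := hT.2.2
    have hc := card_inter_add hd hI.1
    -- The residual bound may be nonpositive; then the child moves straight to its canonical set,
    -- without the induction hypothesis.
    have hstep : ∀ {U : Cotree V}, U.Proper → ∀ {k' : ℤ} {A : Finset V}, U.Indep A →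
        ¬ U.Dominates k' A A →
        (0 < k' → A ≠ U.maxIndep → ∃ n J, TokenWalk (fun X => U.Indep X ∧ k' ≤ X.card) n A J ∧
          U.potential J < U.potential A ∧
          n + 2 * U.potential J + J.card ≤ 2 * U.potential A + A.card) →
        ∃ n J, TokenWalk (fun X => U.Indep X ∧ k' ≤ X.card) n A J ∧
          U.potential J < U.potential A ∧
          n + 2 * U.potential J + J.card ≤ 2 * U.potential A + A.card := by
      intro U hU k' A hA hdom hpos
      have hneA : A ≠ U.maxIndep := by
        intro e
        apply hdom
        nth_rw 1 [e]
        exact dominates_maxIndep _ _ _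
      rcases le_or_gt k' 0 with hk' | hk'
      · exact exists_tokenWalk_maxIndep hU hk' hA hneA
      · exact hpos hk' hneA
    by_cases hL : l.Dominates (k - (I ∩ r.support).card) (I ∩ l.support) (I ∩ l.support)
    · have hR : ¬ r.Dominates (k - (I ∩ l.support).card) (I ∩ r.support) (I ∩ r.support) :=
        fun hR => h (Or.inr ⟨hk, hL, hR⟩)
      obtain ⟨n, J, hw, h1, h2⟩ := hstep hT.2.1 hI.2.2 hR
        (fun h0 hA => hr hT.2.1 hI.2.2 (by omega) hR hA h0)
      have hJ := hw.right.1.subset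
      have e1 := union_inter_left hd (Finset.inter_subset_right (s₁ := I)) hJ
      have e2 := union_inter_right hd (Finset.inter_subset_right (s₁ := I)) hJ
      have hcJ : (I ∩ l.support ∪ J).card = (I ∩ l.support).card + J.card :=
        Finset.card_union_of_disjoint (hd.mono Finset.inter_subset_right hJ)
      refine ⟨n, I ∩ l.support ∪ J, ?_, ?_, ?_⟩
      · have hw' := hw.map_union (Q := fun X => (Cotree.union l r).Indep X ∧ k ≤ X.card)
          (I ∩ l.support) (fun X hX => ?_)
        · rwa [Finset.union_comm, inter_union_inter hI.1, Finset.union_comm] at hw'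
        · rw [Finset.union_comm, Finset.card_union_of_disjoint
            (hd.mono Finset.inter_subset_right hX.1.subset)]
          exact ⟨hI.2.1.union hd hX.1, by push_cast; linarith [hX.2]⟩
      · rw [potential, potential, e1, e2]
        omega
      · rw [potential, potential, e1, e2]
        omega
    · obtain ⟨n, J, hw, h1, h2⟩ := hstep hT.1 hI.2.1 hL
        (fun h0 hA => hl hT.1 hI.2.1 (by omega) hL hA h0)
      have hJ := hw.right.1.subset
      have e1 := union_inter_left hd hJ (Finset.inter_subset_right (s₁ := I))
      have e2 := union_inter_right hd hJ (Finset.inter_subset_right (s₁ := I))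
      have hcJ : (J ∪ I ∩ r.support).card = J.card + (I ∩ r.support).card :=
        Finset.card_union_of_disjoint (hd.mono hJ Finset.inter_subset_right)
      refine ⟨n, J ∪ I ∩ r.support, ?_, ?_, ?_⟩
      · have hw' := hw.map_union (Q := fun X => (Cotree.union l r).Indep X ∧ k ≤ X.card)
          (I ∩ r.support) (fun X hX => ?_)
        · rwa [inter_union_inter hI.1] at hw'
        · rw [Finset.card_union_of_disjoint
            (hd.mono hX.1.subset Finset.inter_subset_right)]
          exact ⟨hX.1.union hd hI.2.2, by push_cast; linarith [hX.2]⟩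
      · rw [potential, potential, e1, e2]
        omega
      · rw [potential, potential, e1, e2]
        omega
  | join l r hl hr =>
    have hd := hT.2.2
    have hn := nonempty_of_le_card hk hkI
    rcases hI with hI | hI
    · have hs := hI.subset
      have hdom : ¬ l.Dominates k I I := fun h' => h (Or.inr ⟨hk, Or.inl ⟨hs, hs, h'⟩⟩)
      have hneI : I ≠ l.maxIndep := by
        intro e
        apply hdom
        nth_rw 1 [e]
        exact dominates_maxIndep _ _ _
      obtain ⟨n, J, hw, h1, h2⟩ := hl hT.1 hI hkI hdom hneI hk
      have h3 := potential_join_le_left l r hw.right.1.subset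
      -- Equality for I, which is not canonical, against an inequality for J: the drop in the child
      -- survives at the join.
      have h4 : (join l r).potential I = l.potential I + r.support.card := by
        rw [potential, if_neg hne, if_pos hs]
      exact ⟨n, J, hw.mono fun X hX => ⟨Or.inl hX.1, hX.2⟩, by omega, by omega⟩
    · have hs := hI.subset
      have hdom : ¬ r.Dominates k I I := fun h' => h (Or.inr ⟨hk, Or.inr ⟨hs, hs, h'⟩⟩)
      have hneI : I ≠ r.maxIndep := by
        intro e
        apply hdom
        nth_rw 1 [e]
        exact dominates_maxIndep _ _ _
      obtain ⟨n, J, hw, h1, h2⟩ := hr hT.2.1 hI hkI hdom hneI hk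
      have h3 := potential_join_le_right hd (nonempty_of_le_card hk hw.right.2)
        hw.right.1.subset
      have h4 : (join l r).potential I = r.potential I + l.support.card := by
        rw [potential, if_neg hne, if_neg (not_subset_of_nonempty hd.symm hn hs)]
      exact ⟨n, J, hw.mono fun X hX => ⟨Or.inr hX.1, hX.2⟩, by omega, by omega⟩

theorem exists_tokenWalk_dominates {T : Cotree V} (hT : T.Proper) {k : ℤ} {I : Finset V}
    (hI : T.Indep I) (hkI : k ≤ I.card) :
    ∃ n S, TokenWalk (fun X => T.Indep X ∧ k ≤ X.card) n I S ∧ T.Dominates k S S ∧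
      n + S.card ≤ 2 * T.potential I + I.card := by
  induction hp : T.potential I using Nat.strong_induction_on generalizing I with
  | _ p ih =>
    by_cases h : T.Dominates k I I
    · exact ⟨0, I, TokenWalk.nil ⟨hI, hkI⟩, h, by omega⟩
    · obtain ⟨n, J, hw, h1, h2⟩ := exists_tokenWalk_of_not_dominates hT hI hkI h
      obtain ⟨m, S, hw', h3, h4⟩ := ih _ (hp ▸ h1) hw.right.1 hw.right.2 rfl
      exact ⟨n + m, S, hw.trans hw', h3, by omega⟩

theorem Dominates.of_tokenWalk {T : Cotree V} (hT : T.Proper) {k : ℤ} {S J J' : Finset V} {n : ℕ}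
    (hS : T.Indep S) (hkS : k ≤ S.card) (hw : TokenWalk (fun X => T.Indep X ∧ k ≤ X.card) n J J')
    (h : T.Dominates k S J) : T.Dominates k S J' := by
  induction hw with
  | nil _ => exact h
  | cons hP hv hw ih =>
    obtain ⟨v, hv⟩ := hv
    refine ih (h.of_comparable hT hS hP.1 hw.left.1 hkS hP.2 hw.left.2 (hv.imp ?_ ?_))
    · rintro rfl
      exact Finset.subset_union_left
    · rintro rfl
      exact Finset.subset_union_left

/-- Both ends reach the same S, in at most 2N - |I| - |S| and 2N - |J| - |S| moves, where N is the
size of the support. Dropping |S| and using |I|, |J| ≥ k gives the constant. -/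
theorem exists_tokenWalk_le {T : Cotree V} (hT : T.Proper) {k : ℤ} {I J : Finset V} {m : ℕ}
    (hw : TokenWalk (fun X => T.Indep X ∧ k ≤ X.card) m I J) :
    ∃ n, TokenWalk (fun X => T.Indep X ∧ k ≤ X.card) n I J ∧
      (n : ℤ) ≤ 4 * T.support.card - 2 * k := by
  obtain ⟨a, S, hwS, hS, ha⟩ := exists_tokenWalk_dominates hT hw.left.1 hw.left.2
  obtain ⟨b, S', hwS', hS', hb⟩ := exists_tokenWalk_dominates hT hw.right.1 hw.right.2
  have hSS' := (hwS.symm.trans hw).trans hwS'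
  obtain ⟨iS, kS⟩ := hwS.right
  obtain ⟨iS', kS'⟩ := hwS'.right
  obtain rfl : S = S' := Dominates.antisymm hT iS iS' kS kS' (hS.of_tokenWalk hT iS kS hSS')
    (hS'.of_tokenWalk hT iS' kS' hSS'.symm)
  have p1 := potential_add_card_le hT hw.left.1
  have p2 := potential_add_card_le hT hw.right.1
  have k1 := hw.left.2
  have k2 := hw.right.2
  exact ⟨a + b, hwS.trans hwS'.symm, by push_cast; omega⟩

end Cotree

/-! ### Transfer to distances in the reconfiguration graph -/

namespace SimpleGraph

variable {V : Type u} [DecidableEq V] {G : SimpleGraph V} {k : ℤ}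

theorem tokenWalk_of_reachable {I J : G.TARVertex k} (h : (G.TAR k).Reachable I J) :
    ∃ n, TokenWalk (fun X => G.IsIndepSet (X : Set V) ∧ k ≤ (X.card : ℤ)) n I.1 J.1 := by
  obtain ⟨w⟩ := h
  induction w with
  | @nil I => exact ⟨0, .nil I.2⟩
  | @cons I _ _ h _ ih =>
    obtain ⟨n, hn⟩ := ih
    exact ⟨n + 1, .cons I.2 h.2 hn⟩

theorem edist_le_of_tokenWalk {C : (G.TAR k).ConnectedComponent} {n : ℕ} {I J : Finset V}
    (hw : TokenWalk (fun X => G.IsIndepSet (X : Set V) ∧ k ≤ (X.card : ℤ)) n I J)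
    (x y : C) (hx : x.1.1 = I) (hy : y.1.1 = J) : C.toSimpleGraph.edist x y ≤ n := by
  induction hw generalizing x with
  | nil _ =>
    obtain rfl : x = y := Subtype.ext (Subtype.ext (hx.trans hy.symm))
    simp
  | @cons n I K J hP hv hw ih =>
    -- A stationary step is no edge, so it is skipped.
    by_cases hIK : I = K
    · exact (ih x (hx.trans hIK) hy).trans (by exact_mod_cast n.le_succ)
    · have hadj : (G.TAR k).Adj x.1 ⟨K, hw.left⟩ := by
        refine ⟨fun e => hIK ?_, ?_⟩
        · rw [← hx, e]
        · rw [hx]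
          exact hv
      have hz : (⟨K, hw.left⟩ : G.TARVertex k) ∈ C.supp :=
        C.mem_supp_of_adj_mem_supp x.2 hadj
      have hadj' : C.toSimpleGraph.Adj x ⟨_, hz⟩ := hadj
      calc C.toSimpleGraph.edist x y
          ≤ C.toSimpleGraph.edist x ⟨_, hz⟩ + C.toSimpleGraph.edist ⟨_, hz⟩ y :=
            SimpleGraph.edist_triangle
        _ ≤ 1 + n := add_le_add (edist_eq_one_iff_adj.2 hadj').le (ih ⟨_, hz⟩ rfl hy)
        _ = ((n + 1 : ℕ) : ℕ∞) := by push_cast; exact add_comm _ _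

end SimpleGraph

theorem mainTheorem7 {V : Type*} [Fintype V] [DecidableEq V] (G : SimpleGraph V)
    (hG : G.IsCograph) (k : ℤ) (C : (G.TAR k).ConnectedComponent) :
    C.toSimpleGraph.ediam ≠ ⊤ ∧
      (C.toSimpleGraph.diam : ℤ) ≤ 4 * (Fintype.card V : ℤ) - 2 * k := by
  obtain ⟨T, hT, hV, rfl⟩ := hG
  have hTp := hT.proper
  have hsupp : T.support = Finset.univ := by
    rw [← Finset.coe_eq_univ, Cotree.coe_support, hV]
  have hind : ∀ X : Finset V, T.Indep X ↔ T.graph.IsIndepSet (X : Set V) :=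
    fun X => Cotree.indep_iff hTp (by rw [hsupp]; exact Finset.subset_univ X)
  have hdist : ∀ x y : C, ∃ n : ℕ, C.toSimpleGraph.edist x y ≤ n ∧
      (n : ℤ) ≤ 4 * (Fintype.card V : ℤ) - 2 * k := by
    intro x y
    obtain ⟨m, hm⟩ := SimpleGraph.tokenWalk_of_reachable (C.reachable_of_mem_supp x.2 y.2)
    simp only [← hind] at hm
    obtain ⟨n, hn, hle⟩ := Cotree.exists_tokenWalk_le hTp hm
    simp only [hind] at hn
    exact ⟨n, SimpleGraph.edist_le_of_tokenWalk hn x y rfl rfl, by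
      rwa [hsupp, Finset.card_univ] at hle⟩
  obtain ⟨x₀, hx₀⟩ := C.nonempty_supp
  obtain ⟨n₀, -, hn₀⟩ := hdist ⟨x₀, hx₀⟩ ⟨x₀, hx₀⟩
  -- The integer bound is nonnegative because the component is nonempty and the bound exceeds or
  -- equals a walk length.
  obtain ⟨N, hN⟩ := Int.eq_ofNat_of_zero_le ((Int.natCast_nonneg n₀).trans hn₀)
  have hle : C.toSimpleGraph.ediam ≤ N := by
    refine SimpleGraph.ediam_le_of_edist_le fun x y => ?_
    obtain ⟨n, h1, h2⟩ := hdist x y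
    exact h1.trans (by exact_mod_cast (by omega : n ≤ N))
  have htop : C.toSimpleGraph.ediam ≠ ⊤ := ne_top_of_le_ne_top (ENat.natCast_ne_top N) hle
  refine ⟨htop, ?_⟩
  rw [hN]
  have : C.toSimpleGraph.diam ≤ N := ENat.toNat_le_of_le_natCast hle
  exact_mod_cast this
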